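/- A matroid is given by its lattice of flats: a finite nonempty lattice $\mathcal L$ with minimum $\emptyset$ and maximum $E$ that is atomic (every element is a join of atoms) and ranked (for each $F$, all maximal chains of $[\emptyset,F]$ have the same length, denoted $\operatorname{rk}(F)$), and whose rank function is submodular: $\operatorname{rk}(F\vee G)+\operatorname{rk}(F\wedge G)\le \operatorname{rk}(F)+\operatorname{rk}(G)$ for all $F,G\in\mathcal L$. Its rank is $r=\operatorname{rk}(E)$. Put $\overline{\mathcal L}=\mathcal L\setminus\{\emptyset\}$. The Chow ring of the matroid is $$\underline A^\bullet=\frac{\mathbb Z[h_F]_{F\in\overline{\mathcal L}}}{\big((h_F-h_{G\vee F})(h_G-h_{G\vee F}) : F,G\in\overline{\mathcal L}\big)+\big(h_a : a\text{ an atom}\big)},$$ graded with each $h_F$ in degree $1$; $\underline A^k$ denotes its degree-$k$ part. **Theorem.** Let $\mathcal L$ be the lattice of flats of a matroid of rank $r$. 1. The monomials $$h_{F_1}^{a_1}\cdots h_{F_\ell}^{a_\ell},\qquad \ell\ge 0,\quad \emptyset=F_0<F_1<\dots<F_\ell,\quad 0<a_i<\operatorname{rk}(F_i)-\operatorname{rk}(F_{i-1})\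 \text{ for } i=1,\dots,\ell,$$ form a $\mathbb Z$-basis of $\underline A^\bullet$. Suppose moreover that $r\ge 1$. Then: 2. There is an isomorphism of abelian groups $\deg\colon\underline A^{r-1}\to\mathbb Z$ such that, for all $F_1,\dots,F_{r-1}\in\overline{\mathcal L}$, $$\deg(h_{F_1}\cdots h_{F_{r-1}})=\begin{cases}1&\text{if }\operatorname{rk}\big(\bigvee_{i\in T}F_i\big)\ge |T|+1\text{ for all }\emptyset\ne T\subseteq\{1,\dots,r-1\},\\0&\text{otherwise.}\end{cases}$$ 3. For every $0\le k\le r-1$ the pairing $\underline A^k\times\underline A^{r-1-k}\to\mathbb Z$, $(a,b)\mapsto\deg(ab)$, with $\deg$ as in part 2, is unimodular, i.e. it induces an isomorphism $\underline A^k\to\operatorname{Hom}(\underline A^{r-1-k},\mathbb Z)$. -/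

import Mathlib

namespace MatroidChow

noncomputable section

/-- The rank of an element `F` of a finite lattice with minimum `⊥`: the length (number of strict
inequalities) of the longest chain ending in `F`, i.e. of the longest chain in `[⊥, F]`. -/
def rk {L : Type*} [Preorder L] (F : L) : ℕ := (Order.height F).toNat

/-- A finite lattice `L` is (the lattice of flats of) a matroid if it is atomic, ranked, and has
submodular rank function. (Nonemptiness is part of `BoundedOrder`; finiteness is imposed
separately through `[Finite L]`.) -/
class IsMatroidLattice (L : Type*) [Lattice L] [BoundedOrder L] : Prop extends
    IsAtomistic L where
  /-- Every maximal chain of the interval `[⊥, F]` has length `rk F`, i.e. `rk F + 1` elements. -/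
  ranked : ∀ (F : L) (c : Set (Set.Icc ⊥ F)), IsMaxChain (· ≤ ·) c → c.ncard = rk F + 1
  submodular : ∀ F G : L, rk (F ⊔ G) + rk (F ⊓ G) ≤ rk F + rk G

section Ring

variable (L : Type*) [Lattice L] [BoundedOrder L]

/-- The nonempty flats, i.e. the elements of `L` other than the minimum. -/
abbrev NonemptyFlat : Type _ := {F : L // F ≠ ⊥}

variable {L} in
/-- The join of two nonempty flats. -/
def join (F G : NonemptyFlat L) : NonemptyFlat L :=
  ⟨F.1 ⊔ G.1, fun h => F.2 (sup_eq_bot_iff.1 h).1⟩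

/-- The ideal of relations of the Chow ring (simplicial presentation). -/
def chowIdeal : Ideal (MvPolynomial (NonemptyFlat L) ℤ) :=
  Ideal.span
    ({p | ∃ F G : NonemptyFlat L,
        p = (MvPolynomial.X F - MvPolynomial.X (join G F)) *
            (MvPolynomial.X G - MvPolynomial.X (join G F))} ∪
     {p | ∃ a : NonemptyFlat L, IsAtom a.1 ∧ p = MvPolynomial.X a})

/-- The Chow ring of the matroid with lattice of flats `L`. -/
abbrev ChowRing : Type _ := MvPolynomial (NonemptyFlat L) ℤ ⧸ chowIdeal L

/-- The graded piece of degree `k` of the Chow ring, each `h_F` having degree `1`: the classes of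
the homogeneous polynomials of degree `k`. -/
def grade (k : ℕ) : Submodule ℤ (ChowRing L) :=
  (MvPolynomial.homogeneousSubmodule (NonemptyFlat L) ℤ k).map
    (Ideal.Quotient.mkₐ ℤ (chowIdeal L)).toLinearMap

variable {L}

/-- The generator `h_F` of the Chow ring. -/
def h (F : NonemptyFlat L) : ChowRing L :=
  Ideal.Quotient.mk (chowIdeal L) (MvPolynomial.X F)

/-- The class in the Chow ring of the monomial with exponent vector `m`, i.e. the (finite) product
of the `h_F ^ (m F)`. -/
def hMonomial (m : NonemptyFlat L →₀ ℕ) : ChowRing L := m.prod fun F a => h F ^ a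

variable (L) in
/-- The exponent vectors of the monomials `h_{F_1}^{a_1} ⋯ h_{F_ℓ}^{a_ℓ}` (`ℓ ≥ 0`) with
`⊥ = F_0 < F_1 < ⋯ < F_ℓ` and `0 < a_i < rk F_i - rk F_{i-1}` for `i = 1, …, ℓ`. -/
def standardExponents : Set (NonemptyFlat L →₀ ℕ) :=
  {m | ∃ (ℓ : ℕ) (F₀ : Fin (ℓ + 1) → L) (F : Fin ℓ → NonemptyFlat L) (a : Fin ℓ → ℕ),
    F₀ 0 = ⊥ ∧ StrictMono F₀ ∧ (∀ i, (F i : L) = F₀ i.succ) ∧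
    (∀ i, 0 < a i ∧ (a i : ℤ) < (rk (F₀ i.succ) : ℤ) - (rk (F₀ i.castSucc) : ℤ)) ∧
    m = ∑ i, Finsupp.single (F i) (a i)}

theorem h_mem_grade (F : NonemptyFlat L) : h F ∈ grade L 1 :=
  ⟨MvPolynomial.X F, MvPolynomial.isHomogeneous_X ℤ F, rfl⟩

theorem mul_mem_grade {k l : ℕ} {x y : ChowRing L} (hx : x ∈ grade L k) (hy : y ∈ grade L l) :
    x * y ∈ grade L (k + l) := by
  obtain ⟨p, hp, rfl⟩ := hx
  obtain ⟨q, hq, rfl⟩ := hy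
  exact ⟨p * q, MvPolynomial.IsHomogeneous.mul hp hq, map_mul (Ideal.Quotient.mk _) p q⟩

theorem prod_h_mem_grade {d : ℕ} (F : Fin d → NonemptyFlat L) : ∏ i, h (F i) ∈ grade L d := by
  refine ⟨∏ i, MvPolynomial.X (F i), ?_, map_prod (Ideal.Quotient.mk (chowIdeal L)) _ _⟩
  have := MvPolynomial.IsHomogeneous.prod (R := ℤ) Finset.univ
    (fun i : Fin d => MvPolynomial.X (F i)) (fun _ => 1)
    (fun i _ => MvPolynomial.isHomogeneous_X ℤ (F i))
  simpa using this

/-- The element `h_{F_1} ⋯ h_{F_d}` of the graded piece of degree `d`. -/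
def hProd {d : ℕ} (F : Fin d → NonemptyFlat L) : grade L d :=
  ⟨∏ i, h (F i), prod_h_mem_grade F⟩

/-- The dragon Hall–Rado condition: `rk (⋁_{i ∈ T} F_i) ≥ |T| + 1` for all nonempty `T`. -/
def DragonHallRado {d : ℕ} (F : Fin d → NonemptyFlat L) : Prop :=
  ∀ T : Finset (Fin d), T.Nonempty → T.card + 1 ≤ rk (T.sup fun i => (F i : L))

/-- The map `A^k → Hom(A^l, ℤ)`, `a ↦ (b ↦ deg (a b))`, attached to `deg : A^d → ℤ`, where
`k + l = d`. -/
def pairing {k l d : ℕ} (hd : k + l = d) (deg : grade L d →ₗ[ℤ] ℤ) :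
    grade L k →ₗ[ℤ] (grade L l →ₗ[ℤ] ℤ) :=
  LinearMap.mk₂ ℤ
    (fun a b => deg ⟨(a : ChowRing L) * (b : ChowRing L), hd ▸ mul_mem_grade a.2 b.2⟩)
    (fun a a' b => by
      rw [← map_add]; congr 1; exact Subtype.ext (add_mul _ _ _))
    (fun c a b => by
      rw [← map_smul]; congr 1; exact Subtype.ext (smul_mul_assoc _ _ _))
    (fun a b b' => by
      rw [← map_add]; congr 1; exact Subtype.ext (mul_add _ _ _))
    (fun c a b => by
      rw [← map_smul]; congr 1; exact Subtype.ext (mul_smul_comm _ _ _))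

end Ring

end

end MatroidChow

/-! The proof rests on one combinatorial quantity. For a monomial `N` in the `h_F` and a flat `G`, the
*excess* of `N` at `G` is `rk G` minus the number of factors `h_F` with `F ≤ G`. It is submodular in
`G`, and the dragon Hall–Rado condition says that it is positive at every flat above the minimum.

*Degree map.* The functional on polynomials given by the dragon Hall–Rado formula vanishes on the
ideal of relations; for the quadratic relations this is a short uncrossing argument with the excess
(`intervalDegree_quadratic`). So it descends to a functional `chowDegree` on the Chow ring.

*Spanning.* The relations imply `h_F h_G ^ n = h_G ^ (n + 1)` for `F ≤ G` and `n ≥ rk G - rk F`, and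
`h_G ^ n = 0` for `n ≥ rk G`. Together with the quadratic relation for incomparable flats, they
rewrite each monomial that is not standard in terms of monomials of the same degree whose factors
have a larger sum of ranks (`hMonomial_mem_span_standard`).

*Duals.* For `F < B` there is a linear form that cuts the degree map of the interval `[⊥, B]` into
the product of those of `[⊥, F]` and `[F, B]` (`exists_splitting_form`, from the identity
`intervalDegree_split`). Let `F_1 < ⋯ < F_ℓ` be the flats of a standard monomial, followed by the
maximum if it is not among them. Cutting at all of them below the maximum, and multiplying in the
powers of the `h_{F_i}` that are missing to the top degrees of the intervals, gives an element of
complementary degree whose pairing with a monomial `N` is nonzero only if, for every `i`, the number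
of factors of `N` below `F_i` but not below `F_{i-1}` is the exponent of `F_i`. Hence `N` is the given
monomial or has a smaller sum of ranks (`IsStandard.exists_isDual`). So the pairings of standard
monomials with these duals form a unitriangular matrix, which yields linear independence, both halves
of Poincaré duality, and, by duality with degree `0`, that the degree map is an isomorphism in top
degree. -/

namespace MatroidChow

section

open scoped Classical

variable {L : Type*} [Lattice L] [BoundedOrder L]

/-! ### Ranks and counts of flats -/

theorem rk_bot : rk (⊥ : L) = 0 := by simp [rk]

theorem rk_lt_rk {P : Type*} [PartialOrder P] [Finite P] {F G : P} (hFG : F < G) : rk F < rk G := by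
  have hfin (x : P) : Order.height x ≠ ⊤ := by
    rw [Ne, Order.height_eq_top_iff]
    intro hx
    have := Fintype.ofFinite P
    obtain ⟨p, -, hp⟩ := hx (Fintype.card P)
    have := p.length_lt_card
    omega
  have hlt := Order.height_strictMono hFG (hfin F).lt_top
  rw [← ENat.natCast_lt_natCast, rk, rk, ENat.natCast_toNat (hfin F), ENat.natCast_toNat (hfin G)]
  exact hlt

theorem rk_le_rk {P : Type*} [PartialOrder P] [Finite P] {F G : P} (hFG : F ≤ G) : rk F ≤ rk G :=
  hFG.lt_or_eq.elim (fun h => (rk_lt_rk h).le) (fun h => h ▸ le_rfl)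

theorem rk_pos [Finite L] {F : L} (hF : F ≠ ⊥) : 0 < rk F :=
  (Nat.zero_le _).trans_lt (rk_lt_rk hF.bot_lt)

theorem rk_atom {a : L} (ha : IsAtom a) : rk a ≤ 1 := by
  have : Order.height a ≤ (1 : ℕ) := by
    rw [Order.height_le_coe_iff]
    intro y hy
    rw [ha.lt_iff.1 hy]
    simp
  simpa [rk] using ENat.toNat_le_toNat this (ENat.natCast_ne_top 1)

/-- The number of factors `h_F` with `F ≤ G` in the monomial with exponent vector `N`, counted with
multiplicity. -/
noncomputable def flatCount (G : L) : (NonemptyFlat L →₀ ℕ) →+ ℕ :=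
  Finsupp.weight fun F => if F.1 ≤ G then 1 else 0

/-- The sum of the ranks of the factors of the monomial with exponent vector `N`. -/
noncomputable def rankWeight : (NonemptyFlat L →₀ ℕ) →+ ℕ :=
  Finsupp.weight fun F => rk F.1

theorem flatCount_single (G : L) (F : NonemptyFlat L) (a : ℕ) :
    flatCount G (Finsupp.single F a) = if F.1 ≤ G then a else 0 := by
  simp [flatCount, Finsupp.weight_single]

theorem rankWeight_single (F : NonemptyFlat L) (a : ℕ) :
    rankWeight (Finsupp.single F a) = a * rk F.1 := by
  simp [rankWeight, Finsupp.weight_single]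

theorem flatCount_bot (N : NonemptyFlat L →₀ ℕ) : flatCount ⊥ N = 0 := by
  induction N using Finsupp.induction_linear with
  | zero => simp
  | add f g hf hg => simp [hf, hg]
  | single F a => simp [flatCount_single, F.2]

theorem flatCount_top (N : NonemptyFlat L →₀ ℕ) : flatCount ⊤ N = N.degree := by
  induction N using Finsupp.induction_linear with
  | zero => simp
  | add f g hf hg => simp [hf, hg]
  | single F a => simp [flatCount_single]

theorem flatCount_supermodular (N : NonemptyFlat L →₀ ℕ) (F G : L) :
    flatCount F N + flatCount G N ≤ flatCount (F ⊔ G) N + flatCount (F ⊓ G) N := by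
  induction N using Finsupp.induction_linear with
  | zero => simp
  | add f g hf hg => simp only [map_add]; omega
  | single H a =>
    simp only [flatCount_single, le_inf_iff]
    have h₁ : H.1 ≤ F → H.1 ≤ F ⊔ G := fun h => h.trans le_sup_left
    have h₂ : H.1 ≤ G → H.1 ≤ F ⊔ G := fun h => h.trans le_sup_right
    split_ifs <;> first | omega | tauto

theorem rankWeight_le [Finite L] (N : NonemptyFlat L →₀ ℕ) :
    rankWeight N ≤ N.degree * rk (⊤ : L) := by
  induction N using Finsupp.induction_linear with
  | zero => simp
  | add f g hf hg => simp only [map_add, add_mul]; omega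
  | single F a =>
    simpa [rankWeight_single] using Nat.mul_le_mul_left a (rk_le_rk (le_top : F.1 ≤ ⊤))

/-- The part of an exponent vector that involves only flats not below `B`. -/
noncomputable def above (B : L) (N : NonemptyFlat L →₀ ℕ) : NonemptyFlat L →₀ ℕ :=
  N.filter fun F => ¬ F.1 ≤ B

theorem above_zero (B : L) : above B (0 : NonemptyFlat L →₀ ℕ) = 0 :=
  Finsupp.filter_zero _

theorem above_add (B : L) (M N : NonemptyFlat L →₀ ℕ) : above B (M + N) = above B M + above B N :=
  Finsupp.filter_add

theorem above_single_of_le {B : L} {F : NonemptyFlat L} (h : F.1 ≤ B) (a : ℕ) :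
    above B (Finsupp.single F a) = 0 :=
  Finsupp.filter_single_of_neg _ (not_not.2 h)

theorem above_single_of_not_le {B : L} {F : NonemptyFlat L} (h : ¬ F.1 ≤ B) (a : ℕ) :
    above B (Finsupp.single F a) = Finsupp.single F a :=
  Finsupp.filter_single_of_pos _ h

theorem above_above {A B : L} (hAB : A ≤ B) (N : NonemptyFlat L →₀ ℕ) :
    above B (above A N) = above B N := by
  ext F
  simp only [above, Finsupp.filter_apply]
  split_ifs with h₁ h₂ <;> first | rfl | exact absurd (h₂.trans hAB) h₁

theorem above_of_above {A B : L} (hAB : A ≤ B) (N : NonemptyFlat L →₀ ℕ) :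
    above A (above B N) = above B N := by
  ext F
  simp only [above, Finsupp.filter_apply]
  split_ifs with h₁ h₂ <;> first | rfl | exact absurd (h₁.trans hAB) ‹_›

theorem flatCount_above_self (B : L) (N : NonemptyFlat L →₀ ℕ) : flatCount B (above B N) = 0 := by
  induction N using Finsupp.induction_linear with
  | zero => simp [above_zero]
  | add f g hf hg => simp [above_add, hf, hg]
  | single F a =>
    by_cases h : F.1 ≤ B
    · simp [above_single_of_le h]
    · simp [above_single_of_not_le h, flatCount_single, h]

theorem flatCount_above {A B : L} (hAB : A ≤ B) (N : NonemptyFlat L →₀ ℕ) :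
    flatCount B (above A N) + flatCount A N = flatCount B N := by
  induction N using Finsupp.induction_linear with
  | zero => simp [above_zero]
  | add f g hf hg => simp only [above_add, map_add]; omega
  | single F a =>
    by_cases h : F.1 ≤ A
    · simp [above_single_of_le h, flatCount_single, h, h.trans hAB]
    · simp [above_single_of_not_le h, flatCount_single, h]

/-- The factors below `B` contribute at most `rk B` each to the rank weight, with equality only for
`B` itself. -/
theorem eq_or_rankWeight_lt [Finite L] (B : NonemptyFlat L) (N : NonemptyFlat L →₀ ℕ) :
    N = Finsupp.single B (flatCount B.1 N) + above B.1 N ∨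
      rankWeight N < flatCount B.1 N * rk B.1 + rankWeight (above B.1 N) := by
  suffices H : ∀ N : NonemptyFlat L →₀ ℕ,
      rankWeight N ≤ flatCount B.1 N * rk B.1 + rankWeight (above B.1 N) ∧
      (N = Finsupp.single B (flatCount B.1 N) + above B.1 N ∨
        rankWeight N < flatCount B.1 N * rk B.1 + rankWeight (above B.1 N)) from (H N).2
  intro N
  induction N using Finsupp.induction_linear with
  | zero => simp [above_zero]
  | add f g hf hg =>
    simp only [above_add, map_add, add_mul]
    refine ⟨by omega, ?_⟩
    rcases hf.2 with h₁ | h₁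
    · rcases hg.2 with h₂ | h₂
      · left
        rw [Finsupp.single_add]
        nth_rewrite 1 [h₁, h₂]
        abel
      · right; omega
    · right; omega
  | single F a =>
    by_cases h : F.1 ≤ B.1
    · simp only [above_single_of_le h, flatCount_single, h, if_true, rankWeight_single, map_zero,
        add_zero]
      refine ⟨Nat.mul_le_mul_left a (rk_le_rk h), ?_⟩
      rcases eq_or_ne F B with rfl | hne
      · exact Or.inl rfl
      rcases Nat.eq_zero_or_pos a with rfl | ha
      · simp
      · exact Or.inr (Nat.mul_lt_mul_of_pos_left
          (rk_lt_rk (lt_of_le_of_ne h fun e => hne (Subtype.ext e))) ha)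
    · simp [above_single_of_not_le h, flatCount_single, h]

/-! ### The excess of a monomial and the degree functionals of intervals -/

/-- The rank of `G` minus the number of factors below `G` of the monomial with exponent vector `N`.
By submodularity of the rank, this is a submodular function of `G`. -/
noncomputable def excess (N : NonemptyFlat L →₀ ℕ) (G : L) : ℤ := rk G - flatCount G N

theorem excess_bot (N : NonemptyFlat L →₀ ℕ) : excess N ⊥ = 0 := by
  simp [excess, rk_bot, flatCount_bot]

theorem excess_add (M N : NonemptyFlat L →₀ ℕ) (G : L) :
    excess (M + N) G = excess N G - flatCount G M := by
  simp only [excess, map_add, Nat.cast_add]; ring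

theorem excess_submodular [IsMatroidLattice L] (N : NonemptyFlat L →₀ ℕ) (F G : L) :
    excess N (F ⊔ G) + excess N (F ⊓ G) ≤ excess N F + excess N G := by
  have h₁ := IsMatroidLattice.submodular F G
  have h₂ := flatCount_supermodular N F G
  simp only [excess]
  omega

/-- The dragon Hall–Rado condition in the interval `[A, B]` for the joins with `A` of those factors
of `N` that are below `B` but not below `A`, together with the condition that their number is the
top degree `rk B - rk A - 1` of the Chow ring of `[A, B]`. It is phrased by the excess: a family
satisfies the dragon Hall–Rado condition if and only if each flat `G` above the minimum has fewer
than `rk G` members of the family below it. -/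
def IsDragon (A B : L) (N : NonemptyFlat L →₀ ℕ) : Prop :=
  (∀ G, A < G → G ≤ B → excess N A + 1 ≤ excess N G) ∧ excess N B = excess N A + 1

/-- The degree map of the Chow ring of the interval `[A, B]`, evaluated at the monomial described in
`IsDragon`. -/
noncomputable def intervalDegree (A B : L) (N : NonemptyFlat L →₀ ℕ) : ℤ :=
  if IsDragon A B N then 1 else 0

theorem isDragon_bot_iff {B : L} {N : NonemptyFlat L →₀ ℕ} :
    IsDragon ⊥ B N ↔ (∀ G, G ≠ ⊥ → G ≤ B → 1 ≤ excess N G) ∧ excess N B = 1 := by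
  simp [IsDragon, excess_bot, bot_lt_iff_ne_bot]

theorem intervalDegree_above {A B : L} (N : NonemptyFlat L →₀ ℕ) (hAB : A ≤ B) :
    intervalDegree A B (above A N) = intervalDegree A B N := by
  have key (G : L) (hG : A ≤ G) : excess (above A N) G = excess N G + flatCount A N := by
    have := flatCount_above hG N
    simp only [excess]
    omega
  have : IsDragon A B (above A N) ↔ IsDragon A B N := by
    simp only [IsDragon, key A le_rfl, key B hAB]
    refine and_congr (forall₃_congr fun G hG _ => ?_) (by omega)
    rw [key G hG.le]
    omega
  simp only [intervalDegree, this]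

end

section

open scoped Classical

variable {L : Type*} [Lattice L] [BoundedOrder L]

/-! ### Monomials in the Chow ring -/

theorem hMonomial_eq_mk (N : NonemptyFlat L →₀ ℕ) :
    hMonomial N = Ideal.Quotient.mk (chowIdeal L) (MvPolynomial.monomial N 1) := by
  rw [MvPolynomial.monomial_eq, map_mul, MvPolynomial.C_1, map_one, one_mul, hMonomial,
    Finsupp.prod, Finsupp.prod, map_prod]
  simp [h]

theorem hMonomial_zero : hMonomial (0 : NonemptyFlat L →₀ ℕ) = 1 := Finsupp.prod_zero_index

theorem hMonomial_add (M N : NonemptyFlat L →₀ ℕ) :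
    hMonomial (M + N) = hMonomial M * hMonomial N :=
  Finsupp.prod_add_index' (fun _ => pow_zero _) (fun _ _ _ => pow_add _ _ _)

theorem hMonomial_single (F : NonemptyFlat L) (a : ℕ) :
    hMonomial (Finsupp.single F a) = h F ^ a :=
  Finsupp.prod_single_index (pow_zero _)

theorem hMonomial_mem_grade (N : NonemptyFlat L →₀ ℕ) : hMonomial N ∈ grade L N.degree :=
  ⟨MvPolynomial.monomial N 1, MvPolynomial.isHomogeneous_monomial 1 rfl, (hMonomial_eq_mk N).symm⟩

theorem grade_eq_span (k : ℕ) :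
    grade L k = Submodule.span ℤ {x | ∃ N : NonemptyFlat L →₀ ℕ, N.degree = k ∧ hMonomial N = x} := by
  apply le_antisymm
  · rintro _ ⟨p, hp, rfl⟩
    rw [SetLike.mem_coe, MvPolynomial.mem_homogeneousSubmodule] at hp
    rw [p.as_sum, map_sum]
    refine Submodule.sum_mem _ fun N hN => ?_
    have hN' : N.degree = k := by
      by_contra hne
      exact (MvPolynomial.mem_support_iff.1 hN) (hp.coeff_eq_zero hne)
    have : MvPolynomial.monomial N (p.coeff N) =
        (p.coeff N) • (MvPolynomial.monomial N (1 : ℤ)) := by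
      rw [MvPolynomial.smul_monomial, smul_eq_mul, mul_one]
    rw [this, map_smul]
    exact Submodule.smul_mem _ _ (Submodule.subset_span ⟨N, hN', hMonomial_eq_mk N⟩)
  · rw [Submodule.span_le]
    rintro _ ⟨N, rfl, rfl⟩
    exact hMonomial_mem_grade N

theorem span_hMonomial :
    Submodule.span ℤ (Set.range (hMonomial : (NonemptyFlat L →₀ ℕ) → ChowRing L)) = ⊤ := by
  rw [eq_top_iff]
  rintro x -
  obtain ⟨p, rfl⟩ := Ideal.Quotient.mk_surjective x
  induction p using MvPolynomial.induction_on' with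
  | monomial N a =>
    have : MvPolynomial.monomial N a = a • (MvPolynomial.monomial N (1 : ℤ)) := by
      rw [MvPolynomial.smul_monomial, smul_eq_mul, mul_one]
    rw [this, map_zsmul, ← hMonomial_eq_mk]
    exact Submodule.smul_mem _ _ (Submodule.subset_span ⟨N, rfl⟩)
  | add p q hp hq =>
    rw [map_add]
    exact add_mem hp hq

/-! ### The degree map -/

/-- The linear functional on polynomials that sends a monomial to the value of the degree map. -/
noncomputable def polyDegree : MvPolynomial (NonemptyFlat L) ℤ →ₗ[ℤ] ℤ :=
  (MvPolynomial.basisMonomials (NonemptyFlat L) ℤ).constr ℤ (intervalDegree ⊥ ⊤)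

theorem polyDegree_monomial (N : NonemptyFlat L →₀ ℕ) (c : ℤ) :
    polyDegree (MvPolynomial.monomial N c) = c * intervalDegree ⊥ ⊤ N := by
  have h1 : polyDegree (MvPolynomial.monomial N (1 : ℤ)) = intervalDegree ⊥ ⊤ N := by
    have := (MvPolynomial.basisMonomials (NonemptyFlat L) ℤ).constr_basis ℤ
      (intervalDegree ⊥ ⊤) N
    rwa [MvPolynomial.coe_basisMonomials] at this
  have : MvPolynomial.monomial N c = c • (MvPolynomial.monomial N (1 : ℤ)) := by
    rw [MvPolynomial.smul_monomial, smul_eq_mul, mul_one]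
  rw [this, map_smul, h1, smul_eq_mul]

theorem excess_single_add (F : NonemptyFlat L) (a : ℕ) (N : NonemptyFlat L →₀ ℕ) (G : L) :
    excess (Finsupp.single F a + N) G = excess N G - if F.1 ≤ G then (a : ℤ) else 0 := by
  rw [excess_add, flatCount_single]
  split_ifs <;> simp

theorem excess_single_self_of_lt {B : NonemptyFlat L} {K : L} (hK : K < B.1) (c : ℕ)
    (N : NonemptyFlat L →₀ ℕ) : excess (Finsupp.single B c + N) K = excess N K := by
  rw [excess_single_add, if_neg hK.not_ge, sub_zero]

/-- The degree of a monomial with an atom among its factors vanishes, as an atom has rank `1`. -/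
theorem intervalDegree_atom (B : L) (a : NonemptyFlat L) (ha : IsAtom a.1)
    (N : NonemptyFlat L →₀ ℕ) (hB : a.1 ≤ B) :
    intervalDegree ⊥ B (Finsupp.single a 1 + N) = 0 := by
  rw [intervalDegree, if_neg]
  rw [isDragon_bot_iff]
  rintro ⟨hpos, -⟩
  have h₁ := hpos a.1 a.2 hB
  have h₂ := rk_atom ha
  rw [excess_single_add, if_pos le_rfl, excess] at h₁
  omega

/-- The degree functional respects the quadratic relations. If `H = F ⊔ G`, the four monomials differ
only in the conditions that they impose on the excess of `N`: it has to be at least `3` above `H`,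
and at least `2` above `F` resp. `G` whenever `F` resp. `G` is a factor. By submodularity, the first
condition implies that the second holds for `F` or for `G`. -/
theorem intervalDegree_quadratic [IsMatroidLattice L] (F G : NonemptyFlat L)
    (N : NonemptyFlat L →₀ ℕ) :
    intervalDegree ⊥ ⊤ (Finsupp.single F 1 + (Finsupp.single G 1 + N)) +
      intervalDegree ⊥ ⊤ (Finsupp.single (join G F) 1 + (Finsupp.single (join G F) 1 + N)) =
    intervalDegree ⊥ ⊤ (Finsupp.single F 1 + (Finsupp.single (join G F) 1 + N)) +
      intervalDegree ⊥ ⊤ (Finsupp.single G 1 + (Finsupp.single (join G F) 1 + N)) := by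
  have hjoin (K : L) : (join G F).1 ≤ K ↔ F.1 ≤ K ∧ G.1 ≤ K := by
    simp [join, and_comm]
  have expand (A B : NonemptyFlat L) :
      IsDragon ⊥ ⊤ (Finsupp.single A 1 + (Finsupp.single B 1 + N)) ↔
        (∀ K, K ≠ ⊥ → 1 + (if A.1 ≤ K then 1 else 0) + (if B.1 ≤ K then 1 else 0) ≤ excess N K) ∧
          excess N ⊤ = 3 := by
    simp only [isDragon_bot_iff, excess_single_add, le_top, if_true, forall_const, Nat.cast_one]
    refine and_congr (forall₂_congr fun K _ => ?_) ?_ <;>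
    constructor <;> intro _ <;> linarith
  by_cases hP : (∀ K, K ≠ ⊥ → 1 ≤ excess N K) ∧
      (∀ K, F.1 ≤ K → G.1 ≤ K → 3 ≤ excess N K) ∧ excess N ⊤ = 3
  · obtain ⟨h1, h3, htop⟩ := hP
    have ne (A : NonemptyFlat L) (K : L) (hA : A.1 ≤ K) : K ≠ ⊥ :=
      fun hK => A.2 (le_bot_iff.1 (hK ▸ hA))
    have hHH : IsDragon ⊥ ⊤ (Finsupp.single (join G F) 1 + (Finsupp.single (join G F) 1 + N)) := by
      refine (expand _ _).2 ⟨fun K hK => ?_, htop⟩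
      simp only [hjoin]
      split_ifs with hF
      · exact h3 K hF.1 hF.2
      · simpa using h1 K hK
    have hFH : IsDragon ⊥ ⊤ (Finsupp.single F 1 + (Finsupp.single (join G F) 1 + N)) ↔
        ∀ K, F.1 ≤ K → 2 ≤ excess N K := by
      rw [expand]
      refine ⟨fun hd K hK => ?_, fun hd => ⟨fun K hK => ?_, htop⟩⟩
      · have := hd.1 K (ne F K hK)
        rw [if_pos hK] at this
        split_ifs at this <;> omega
      · simp only [hjoin]
        split_ifs with hF hFG hFG
        · exact h3 K hFG.1 hFG.2
        · exact hd K hF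
        · exact absurd hFG.1 hF
        · simpa using h1 K hK
    have hGH : IsDragon ⊥ ⊤ (Finsupp.single G 1 + (Finsupp.single (join G F) 1 + N)) ↔
        ∀ K, G.1 ≤ K → 2 ≤ excess N K := by
      rw [expand]
      refine ⟨fun hd K hK => ?_, fun hd => ⟨fun K hK => ?_, htop⟩⟩
      · have := hd.1 K (ne G K hK)
        rw [if_pos hK] at this
        split_ifs at this <;> omega
      · simp only [hjoin]
        split_ifs with hG hFG hFG
        · exact h3 K hFG.1 hFG.2
        · exact hd K hG
        · exact absurd hFG.2 hG
        · simpa using h1 K hK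
    have hFG : IsDragon ⊥ ⊤ (Finsupp.single F 1 + (Finsupp.single G 1 + N)) ↔
        (∀ K, F.1 ≤ K → 2 ≤ excess N K) ∧ ∀ K, G.1 ≤ K → 2 ≤ excess N K := by
      rw [expand]
      refine ⟨fun hd => ⟨fun K hK => ?_, fun K hK => ?_⟩, fun hd => ⟨fun K hK => ?_, htop⟩⟩
      · have := hd.1 K (ne F K hK)
        rw [if_pos hK] at this
        split_ifs at this <;> omega
      · have := hd.1 K (ne G K hK)
        rw [if_pos hK] at this
        split_ifs at this <;> omega
      · split_ifs with hF hG hG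
        · exact h3 K hF hG
        · exact hd.1 K hF
        · exact hd.2 K hG
        · simpa using h1 K hK
    have hor : (∀ K, F.1 ≤ K → 2 ≤ excess N K) ∨ ∀ K, G.1 ≤ K → 2 ≤ excess N K := by
      by_contra! hcon
      obtain ⟨⟨K, hFK, hK⟩, K', hGK', hK'⟩ := hcon
      have hsub := excess_submodular N K K'
      have hsup := h3 (K ⊔ K') (hFK.trans le_sup_left) (hGK'.trans le_sup_right)
      have hinf : 0 ≤ excess N (K ⊓ K') := by
        rcases eq_or_ne (K ⊓ K') ⊥ with hb | hb
        · rw [hb, excess_bot]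
        · exact zero_le_one.trans (h1 _ hb)
      omega
    simp only [intervalDegree, hFG, hFH, hGH, if_pos hHH]
    rcases hor with hF | hG
    · simp only [and_iff_right hF, if_pos hF]
      exact add_comm _ _
    · simp only [and_iff_left hG, if_pos hG]
  · have neg (A B : NonemptyFlat L) (hA : ∀ K, F.1 ≤ K → G.1 ≤ K → A.1 ≤ K ∧ B.1 ≤ K) :
        ¬ IsDragon ⊥ ⊤ (Finsupp.single A 1 + (Finsupp.single B 1 + N)) := by
      rw [expand]
      rintro ⟨hd, htop⟩
      refine hP ⟨fun K hK => ?_, fun K hF hG => ?_, htop⟩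
      · have := hd K hK
        split_ifs at this <;> omega
      · have := hd K fun hK => F.2 (le_bot_iff.1 (hK ▸ hF))
        rw [if_pos (hA K hF hG).1, if_pos (hA K hF hG).2] at this
        exact this
    rw [intervalDegree, intervalDegree, intervalDegree, intervalDegree, if_neg, if_neg, if_neg,
      if_neg]
    all_goals
      refine neg _ _ fun K hF hG => ?_
      simp [hjoin, hF, hG]

theorem polyDegree_eq_zero [IsMatroidLattice L] {p : MvPolynomial (NonemptyFlat L) ℤ}
    (hp : p ∈ chowIdeal L) : polyDegree p = 0 := by
  suffices H : ∀ q, polyDegree (q * p) = 0 by simpa using H 1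
  induction hp using Submodule.span_induction with
  | zero => simp
  | add x y _ _ hx hy => intro q; rw [mul_add, map_add, hx, hy, add_zero]
  | smul a x _ hx => intro q; rw [smul_eq_mul, ← mul_assoc]; exact hx _
  | mem x hx =>
    intro q
    induction q using MvPolynomial.induction_on' with
    | add q q' hq hq' => rw [add_mul, map_add, hq, hq', add_zero]
    | monomial N c =>
      have hX (F : NonemptyFlat L) (M : NonemptyFlat L →₀ ℕ) :
          MvPolynomial.monomial M c * MvPolynomial.X F =
            MvPolynomial.monomial (Finsupp.single F 1 + M) c := by
        rw [MvPolynomial.X, MvPolynomial.monomial_mul, mul_one, add_comm]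
      rcases hx with ⟨F, G, rfl⟩ | ⟨a, ha, rfl⟩
      · have e : MvPolynomial.monomial N c *
            ((MvPolynomial.X F - MvPolynomial.X (join G F)) *
              (MvPolynomial.X G - MvPolynomial.X (join G F))) =
            MvPolynomial.monomial N c * MvPolynomial.X G * MvPolynomial.X F
            + MvPolynomial.monomial N c * MvPolynomial.X (join G F) * MvPolynomial.X (join G F)
            - MvPolynomial.monomial N c * MvPolynomial.X (join G F) * MvPolynomial.X F
            - MvPolynomial.monomial N c * MvPolynomial.X (join G F) * MvPolynomial.X G := by
          ring
        rw [e]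
        simp only [hX, map_add, map_sub, polyDegree_monomial]
        linear_combination c * intervalDegree_quadratic F G N
      · rw [hX, polyDegree_monomial, intervalDegree_atom ⊤ a ha N le_top, mul_zero]

/-- The degree map of the Chow ring, extended by zero to all degrees. -/
noncomputable def chowDegree [IsMatroidLattice L] : ChowRing L →ₗ[ℤ] ℤ :=
  ((chowIdeal L).restrictScalars ℤ).liftQ polyDegree (fun _ hp => polyDegree_eq_zero hp) ∘ₗ
    (Submodule.Quotient.restrictScalarsEquiv ℤ (chowIdeal L)).symm.toLinearMap

theorem chowDegree_hMonomial [IsMatroidLattice L] (N : NonemptyFlat L →₀ ℕ) :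
    chowDegree (hMonomial N) = intervalDegree ⊥ ⊤ N := by
  rw [hMonomial_eq_mk, ← one_mul (intervalDegree ⊥ ⊤ N), ← polyDegree_monomial]
  rfl

theorem isDragon_sum_single_iff [Finite L] {d : ℕ} (hd : d + 1 = rk (⊤ : L))
    (F : Fin d → NonemptyFlat L) :
    IsDragon ⊥ ⊤ (∑ i, Finsupp.single (F i) 1) ↔ DragonHallRado F := by
  have hcount (G : L) : flatCount G (∑ i, Finsupp.single (F i) 1) =
      (Finset.univ.filter fun i => (F i).1 ≤ G).card := by
    simp [flatCount_single]
  have htop : excess (∑ i, Finsupp.single (F i) 1) (⊤ : L) = 1 := by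
    rw [excess, hcount, ← hd]
    simp
  rw [isDragon_bot_iff, and_iff_left htop]
  simp only [excess, hcount, le_top, forall_const]
  constructor
  · intro H T hT
    obtain ⟨i, hi⟩ := hT
    have hne : (T.sup fun i => (F i : L)) ≠ ⊥ := fun hb => by
      have := Finset.le_sup (f := fun i => (F i : L)) hi
      rw [hb, le_bot_iff] at this
      exact (F i).2 this
    have h₁ := H _ hne
    have h₂ : T.card ≤ (Finset.univ.filter fun j => (F j).1 ≤ T.sup fun i => (F i : L)).card :=
      Finset.card_le_card fun j hj => by
        simpa using Finset.le_sup (f := fun i => (F i : L)) hj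
    omega
  · intro H G hG
    rcases (Finset.univ.filter fun i => (F i).1 ≤ G).eq_empty_or_nonempty with hT | hT
    · rw [hT, Finset.card_empty]
      have := rk_pos hG
      omega
    · have h₁ := H _ hT
      have h₂ : rk ((Finset.univ.filter fun i => (F i).1 ≤ G).sup fun i => (F i : L)) ≤ rk G :=
        rk_le_rk (Finset.sup_le fun i hi => (Finset.mem_filter.1 hi).2)
      omega

end

section

open scoped Classical

variable {L : Type*} [Lattice L] [BoundedOrder L]

/-! ### Straightening -/

theorem h_mul_h (F G : NonemptyFlat L) :
    h F * h G = h F * h (join G F) + h G * h (join G F) - h (join G F) * h (join G F) := by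
  have : (h F - h (join G F)) * (h G - h (join G F)) = 0 := by
    simp only [h, ← map_sub, ← map_mul]
    exact Ideal.Quotient.eq_zero_iff_mem.2 (Ideal.subset_span (Or.inl ⟨F, G, rfl⟩))
  linear_combination this

theorem h_atom (a : NonemptyFlat L) (ha : IsAtom a.1) : h a = 0 :=
  Ideal.Quotient.eq_zero_iff_mem.2 (Ideal.subset_span (Or.inr ⟨a, ha, rfl⟩))

/-- If `F ≤ G` then `h_F h_G ^ n = h_G ^ (n + 1)` for `n ≥ rk G - rk F`. For an atom `a ≰ F`, the
quadratic relation of `F` and `a` says `h_F h_{F ⊔ a} = h_{F ⊔ a} ^ 2`; one climbs from `F` to `G`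
by adding atoms. -/
theorem h_mul_h_pow [Finite L] [IsMatroidLattice L] (F G : NonemptyFlat L) (n : ℕ)
    (hFG : F.1 ≤ G.1) (hn : rk G.1 ≤ n + rk F.1) : h F * h G ^ n = h G ^ (n + 1) := by
  induction n generalizing F with
  | zero =>
    have : F = G := by
      by_contra hne
      have := rk_lt_rk (lt_of_le_of_ne hFG fun e => hne (Subtype.ext e))
      omega
    rw [this]; ring
  | succ n ih =>
    by_cases hGF : G.1 ≤ F.1
    · rw [Subtype.ext (le_antisymm hFG hGF)]; ring
    obtain ⟨a, ha, haG, haF⟩ : ∃ a, IsAtom a ∧ a ≤ G.1 ∧ ¬ a ≤ F.1 := by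
      by_contra! hcon
      exact hGF (le_iff_atom_le_imp.2 hcon)
    let a' : NonemptyFlat L := ⟨a, ha.1⟩
    have hlt : F.1 < (join a' F).1 := lt_of_le_of_ne le_sup_right fun e => haF (e ▸ le_sup_left)
    have hrk := rk_lt_rk hlt
    have hF' := ih (join a' F) (sup_le haG hFG) (by omega)
    have hrel := h_mul_h F a'
    rw [h_atom a' ha] at hrel
    have e₁ : h (join a' F) * h G ^ (n + 1) = h G ^ (n + 1 + 1) := by
      rw [pow_succ, ← mul_assoc, hF']
      ring
    calc h F * h G ^ (n + 1) = h F * (h (join a' F) * h G ^ n) := by rw [hF']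
      _ = h (join a' F) * (h (join a' F) * h G ^ n) := by linear_combination (-h G ^ n) * hrel
      _ = h G ^ (n + 1 + 1) := by rw [hF', e₁]

theorem h_pow_eq_zero [Finite L] [IsMatroidLattice L] (G : NonemptyFlat L) (n : ℕ)
    (hn : rk G.1 ≤ n) : h G ^ n = 0 := by
  obtain ⟨a, ha, haG⟩ : ∃ a, IsAtom a ∧ a ≤ G.1 :=
    (eq_bot_or_exists_atom_le G.1).resolve_left G.2
  have hpos := rk_pos ha.1
  obtain ⟨n, rfl⟩ : ∃ m, n = m + 1 := ⟨n - 1, by have := rk_pos G.2; omega⟩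
  rw [← h_mul_h_pow ⟨a, ha.1⟩ G n haG (by simp only; omega), h_atom ⟨a, ha.1⟩ ha, zero_mul]

/-- An intrinsic description of `standardExponents`: the flats that occur form a chain, and each
exponent is smaller than the rank of its flat, and than the rank difference to each smaller flat
that occurs. -/
structure IsStandard (m : NonemptyFlat L →₀ ℕ) : Prop where
  isChain : IsChain (· ≤ ·) (m.support : Set (NonemptyFlat L))
  lt_rk : ∀ F ∈ m.support, m F < rk F.1
  add_rk_lt_rk : ∀ G ∈ m.support, ∀ F ∈ m.support, G < F → m F + rk G.1 < rk F.1

theorem IsStandard.erase {m : NonemptyFlat L →₀ ℕ} (hm : IsStandard m) (F : NonemptyFlat L) :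
    IsStandard (m.erase F) := by
  have hsub {G : NonemptyFlat L} (hG : G ∈ (m.erase F).support) :
      G ∈ m.support ∧ m.erase F G = m G := by
    rw [Finsupp.support_erase, Finset.mem_erase] at hG
    exact ⟨hG.2, Finsupp.erase_ne hG.1⟩
  refine ⟨hm.isChain.mono fun G hG => (hsub hG).1, fun G hG => ?_, fun G hG K hK hGK => ?_⟩
  · rw [(hsub hG).2]
    exact hm.lt_rk G (hsub hG).1
  · rw [(hsub hK).2]
    exact hm.add_rk_lt_rk G (hsub hG).1 K (hsub hK).1 hGK

theorem isStandard_of_mem_standardExponents [Finite L] {m : NonemptyFlat L →₀ ℕ}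
    (hm : m ∈ standardExponents L) : IsStandard m := by
  obtain ⟨ℓ, F₀, F, a, h0, hmono, hF, ha, rfl⟩ := hm
  have hlt (i j : Fin ℓ) : i < j → F i < F j := fun hij => by
    rw [← Subtype.coe_lt_coe, hF, hF]
    exact hmono (Fin.succ_lt_succ_iff.2 hij)
  have hinj : Function.Injective F := fun i j hij => by
    rcases lt_trichotomy i j with h | h | h
    · exact absurd hij (hlt i j h).ne
    · exact h
    · exact absurd hij (hlt j i h).ne'
  have hval (i : Fin ℓ) : (∑ j, Finsupp.single (F j) (a j)) (F i) = a i := by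
    rw [Finsupp.finsetSum_apply, Finset.sum_eq_single i]
    · simp
    · intro j _ hj
      exact Finsupp.single_eq_of_ne (hinj.ne hj).symm
    · simp
  have hsupp : ∀ G ∈ (∑ j, Finsupp.single (F j) (a j)).support, ∃ i, G = F i := by
    intro G hG
    by_contra! hcon
    rw [Finsupp.mem_support_iff, Finsupp.finsetSum_apply] at hG
    exact hG (Finset.sum_eq_zero fun j _ => Finsupp.single_eq_of_ne (hcon j))
  refine ⟨?_, ?_, ?_⟩
  · intro G hG G' hG' _
    obtain ⟨i, rfl⟩ := hsupp G hG
    obtain ⟨j, rfl⟩ := hsupp G' hG'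
    rcases lt_trichotomy i j with h | h | h
    · exact Or.inl (hlt i j h).le
    · exact Or.inl (h ▸ le_rfl)
    · exact Or.inr (hlt j i h).le
  · intro G hG
    obtain ⟨i, rfl⟩ := hsupp G hG
    rw [hval, hF]
    have := (ha i).2
    omega
  · intro G' hG' G hG hlt'
    obtain ⟨i, rfl⟩ := hsupp G hG
    obtain ⟨j, rfl⟩ := hsupp G' hG'
    have hji : j < i := by
      by_contra hij
      rcases (not_lt.1 hij).lt_or_eq with h | h
      · exact lt_asymm hlt' (hlt i j h)
      · exact hlt'.ne (h ▸ rfl)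
    rw [hval, hF, hF]
    have h₁ := (ha i).2
    have h₂ : rk (F₀ j.succ) ≤ rk (F₀ i.castSucc) :=
      rk_le_rk (hmono.monotone (Fin.succ_le_castSucc_iff.2 hji))
    omega

theorem mem_standardExponents_of_isStandard {m : NonemptyFlat L →₀ ℕ}
    (hm : IsStandard m) : m ∈ standardExponents L := by
  let _ : LinearOrder m.support := hm.isChain.linearOrder
  let e := monoEquivOfFin m.support (Fintype.card_coe m.support)
  have hlt : ∀ i j, i < j → (e i).1.1 < (e j).1.1 := fun i j hij => e.strictMono hij
  refine ⟨m.support.card, Fin.cons ⊥ fun i => (e i).1.1, fun i => (e i).1, fun i => m (e i).1,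
    rfl, ?_, fun i => rfl, fun i => ⟨Nat.pos_of_ne_zero (Finsupp.mem_support_iff.1 (e i).2), ?_⟩, ?_⟩
  · intro i j hij
    refine Fin.cases ?_ (fun j hij => ?_) j hij
    · intro hij
      exact absurd hij (Fin.not_lt_zero i)
    · refine Fin.cases (fun _ => ?_) (fun i hij => ?_) i hij
      · exact bot_lt_iff_ne_bot.2 (e j).1.2
      · exact hlt i j (Fin.succ_lt_succ_iff.1 hij)
  · rw [Fin.cons_succ]
    change (m (e i).1 : ℤ) < _
    rcases Nat.eq_zero_or_pos i.1 with h0 | hpos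
    · have : i.castSucc = 0 := Fin.ext h0
      rw [this, Fin.cons_zero, rk_bot]
      have := hm.lt_rk _ (e i).2
      omega
    · let j : Fin m.support.card := ⟨i.1 - 1, by omega⟩
      have : i.castSucc = j.succ := Fin.ext (by simp [j]; omega)
      rw [this, Fin.cons_succ]
      have hji : j < i := Fin.lt_def.2 (by simp [j]; omega)
      have := hm.add_rk_lt_rk _ (e j).2 _ (e i).2 (hlt j i hji)
      omega
  · have := e.toEquiv.sum_comp fun x => Finsupp.single x.1 (m x.1)
    refine Eq.trans ?_ this.symm
    rw [Finset.sum_coe_sort m.support fun x => Finsupp.single x (m x)]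
    exact m.sum_single.symm

theorem exists_add_single_add_single {m : NonemptyFlat L →₀ ℕ} {F G : NonemptyFlat L} (hFG : F ≠ G)
    {a b : ℕ} (ha : a ≤ m F) (hb : b ≤ m G) :
    ∃ n, m = n + Finsupp.single F a + Finsupp.single G b := by
  refine ⟨m - (Finsupp.single F a + Finsupp.single G b), ?_⟩
  rw [add_assoc, tsub_add_cancel_of_le]
  intro K
  simp only [Finsupp.add_apply, Finsupp.single_apply]
  split_ifs with h₁ h₂
  · exact absurd (h₁.trans h₂.symm) hFG
  · simpa [← h₁] using ha
  · rename_i h₂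
    simpa [← h₂] using hb
  · simp

/-- Straightening: a monomial that is not standard is a combination of monomials of the same degree
and larger rank weight, which is bounded. -/
theorem hMonomial_mem_span_standard [Finite L] [IsMatroidLattice L] (m : NonemptyFlat L →₀ ℕ) :
    hMonomial m ∈ Submodule.span ℤ
      (hMonomial '' {n | IsStandard n ∧ n.degree = m.degree}) := by
  induction hd : m.degree * rk (⊤ : L) - rankWeight m using Nat.strong_induction_on
    generalizing m with
  | _ d ih =>
  have step (n : NonemptyFlat L →₀ ℕ) (hdeg : n.degree = m.degree)
      (hw : rankWeight m < rankWeight n) : hMonomial n ∈ Submodule.span ℤ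
      (hMonomial '' {n | IsStandard n ∧ n.degree = m.degree}) := by
    have hle := rankWeight_le n
    rw [hdeg] at hle
    have := ih _ (by rw [hdeg]; omega) n rfl
    rwa [hdeg] at this
  by_cases hm : IsStandard m
  · exact Submodule.subset_span ⟨m, ⟨hm, rfl⟩, rfl⟩
  by_cases hrk : ∃ F ∈ m.support, rk F.1 ≤ m F
  · obtain ⟨F, -, hF⟩ := hrk
    rw [← Finsupp.erase_add_single F m, hMonomial_add, hMonomial_single, h_pow_eq_zero F _ hF,
      mul_zero]
    exact zero_mem _
  by_cases hgap : ∃ G ∈ m.support, ∃ F ∈ m.support, G < F ∧ rk F.1 ≤ m F + rk G.1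
  · obtain ⟨G, hG, F, -, hGF, hle⟩ := hgap
    obtain ⟨n, hn⟩ := exists_add_single_add_single hGF.ne
      (Nat.pos_of_ne_zero (Finsupp.mem_support_iff.1 hG)) (le_refl (m F))
    have hmul : hMonomial m = hMonomial (n + Finsupp.single F (m F + 1)) := by
      rw [hn]
      simp only [hMonomial_add, hMonomial_single, pow_one, mul_assoc]
      rw [← hn, h_mul_h_pow G F _ hGF.le hle]
    rw [hmul]
    have hlt := rk_lt_rk (Subtype.coe_lt_coe.2 hGF)
    refine step _ ?_ ?_
    · have := congrArg Finsupp.degree hn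
      simp only [map_add, Finsupp.degree_single] at this ⊢
      omega
    · have := congrArg rankWeight hn
      simp only [map_add, rankWeight_single, add_mul, one_mul] at this ⊢
      omega
  by_cases hinc : ∃ F ∈ m.support, ∃ G ∈ m.support, ¬ F ≤ G ∧ ¬ G ≤ F
  · obtain ⟨F, hF, G, hG, hFG, hGF⟩ := hinc
    obtain ⟨n, hn⟩ := exists_add_single_add_single (fun e => hFG e.le : F ≠ G)
      (Nat.pos_of_ne_zero (Finsupp.mem_support_iff.1 hF))
      (Nat.pos_of_ne_zero (Finsupp.mem_support_iff.1 hG))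
    have hrkF : rk F.1 < rk (join G F).1 :=
      rk_lt_rk (lt_of_le_of_ne le_sup_right fun e => hGF (le_sup_left.trans_eq e.symm))
    have hrkG : rk G.1 < rk (join G F).1 :=
      rk_lt_rk (lt_of_le_of_ne le_sup_left fun e => hFG (le_sup_right.trans_eq e.symm))
    have hmul : hMonomial m =
        hMonomial (n + Finsupp.single F 1 + Finsupp.single (join G F) 1) +
        hMonomial (n + Finsupp.single G 1 + Finsupp.single (join G F) 1) -
        hMonomial (n + Finsupp.single (join G F) 1 + Finsupp.single (join G F) 1) := by
      rw [hn]
      simp only [hMonomial_add, hMonomial_single, pow_one]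
      linear_combination hMonomial n * h_mul_h F G
    rw [hmul]
    refine sub_mem (add_mem (step _ ?_ ?_) (step _ ?_ ?_)) (step _ ?_ ?_)
    all_goals
      rw [hn]
      simp only [map_add, Finsupp.degree_single, rankWeight_single, one_mul]
      try omega
  · push Not at hrk hgap hinc
    refine absurd ⟨fun F hF G hG _ => ?_, hrk, hgap⟩ hm
    exact or_iff_not_imp_left.2 (hinc F hF G hG)

end

section

open scoped Classical

variable {L : Type*} [Lattice L] [BoundedOrder L] [IsMatroidLattice L]

/-! ### Splitting an interval -/

/-- If `[⊥, B]` is dragon for `N` with the additional factor `B`, then replacing this factor by `F`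
destroys the dragon condition exactly if `N` has excess `1` at some flat in `[F, B)`. By
submodularity these flats are closed under joins, and the largest of them is the only `G` for which
both `[⊥, G]` and `[G, B]` are dragon for `N`. In all other cases both sides vanish. -/
theorem intervalDegree_split [Finite L] (F : NonemptyFlat L) (B : NonemptyFlat L) (hFB : F < B)
    (N : NonemptyFlat L →₀ ℕ) (s : Finset (NonemptyFlat L))
    (hs : ∀ G, G ∈ s ↔ F ≤ G ∧ G < B) :
    intervalDegree ⊥ B.1 (Finsupp.single B 1 + N) - intervalDegree ⊥ B.1 (Finsupp.single F 1 + N) =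
      ∑ G ∈ s, intervalDegree ⊥ G.1 N * intervalDegree G.1 B.1 N := by
  have hFB' : F.1 ≤ B.1 := hFB.le
  have ne {K : L} (hK : F.1 ≤ K) : K ≠ ⊥ := fun hb => F.2 (le_bot_iff.1 (hb ▸ hK))
  have hdB : IsDragon ⊥ B.1 (Finsupp.single B 1 + N) ↔
      (∀ K, K ≠ ⊥ → K < B.1 → 1 ≤ excess N K) ∧ excess N B.1 = 2 := by
    simp only [isDragon_bot_iff, excess_single_add, le_refl, if_true, Nat.cast_one]
    constructor
    · rintro ⟨h₁, h₂⟩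
      refine ⟨fun K hK hKB => ?_, by omega⟩
      have := h₁ K hK hKB.le
      rwa [if_neg hKB.not_ge, sub_zero] at this
    · rintro ⟨h₁, h₂⟩
      refine ⟨fun K hK hKB => ?_, by omega⟩
      rcases hKB.lt_or_eq with hlt | rfl
      · rw [if_neg hlt.not_ge, sub_zero]
        exact h₁ K hK hlt
      · rw [if_pos le_rfl]
        omega
  have hdF : IsDragon ⊥ B.1 (Finsupp.single F 1 + N) ↔
      IsDragon ⊥ B.1 (Finsupp.single B 1 + N) ∧ ∀ K, F.1 ≤ K → K < B.1 → excess N K ≠ 1 := by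
    rw [hdB]
    simp only [isDragon_bot_iff, excess_single_add, if_pos hFB', Nat.cast_one]
    constructor
    · rintro ⟨h₁, h₂⟩
      refine ⟨⟨fun K hK hKB => ?_, by omega⟩, fun K hK hKB => ?_⟩
      · have := h₁ K hK hKB.le
        split_ifs at this <;> omega
      · have := h₁ K (ne hK) hKB.le
        rw [if_pos hK] at this
        omega
    · rintro ⟨⟨h₁, h₂⟩, h₃⟩
      refine ⟨fun K hK hKB => ?_, by omega⟩
      rcases hKB.lt_or_eq with hlt | rfl
      · have := h₁ K hK hlt
        split_ifs with hFK
        · have := h₃ K hFK hlt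
          omega
        · omega
      · rw [if_pos hFB']
        omega
  have hsplit {G : NonemptyFlat L} (h₁ : IsDragon ⊥ G.1 N) (h₂ : IsDragon G.1 B.1 N) :
      (∀ K, K ≠ ⊥ → K ≤ G.1 → 1 ≤ excess N K) ∧ excess N G.1 = 1 ∧
      (∀ K, G.1 < K → K ≤ B.1 → 2 ≤ excess N K) ∧ excess N B.1 = 2 := by
    rw [isDragon_bot_iff] at h₁
    obtain ⟨h₃, h₄⟩ := h₂
    rw [h₁.2] at h₃ h₄
    exact ⟨h₁.1, h₁.2, h₃, h₄⟩
  by_cases hd : IsDragon ⊥ B.1 (Finsupp.single B 1 + N)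
  · obtain ⟨hpos, hB⟩ := hdB.1 hd
    by_cases hex : ∃ K, F.1 ≤ K ∧ K < B.1 ∧ excess N K = 1
    · obtain ⟨K, hFK, hKB, hK⟩ := hex
      obtain ⟨G, -, hG⟩ := (Set.toFinite
        {G | F.1 ≤ G ∧ G < B.1 ∧ excess N G = 1}).exists_le_maximal (show K ∈ _ from ⟨hFK, hKB, hK⟩)
      obtain ⟨⟨hFG, hGB, hG1⟩, hmax⟩ := hG
      let G' : NonemptyFlat L := ⟨G, ne hFG⟩
      have hG₁ : IsDragon ⊥ G'.1 N :=
        isDragon_bot_iff.2 ⟨fun K hK hKG => hpos K hK (hKG.trans_lt hGB), hG1⟩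
      have hG₂ : IsDragon G'.1 B.1 N := by
        refine ⟨fun K hGK hKB => ?_, ?_⟩
        · change excess N G + 1 ≤ _
          rw [hG1]
          rcases hKB.lt_or_eq with hlt | rfl
          · have h1 := hpos K (ne (hFG.trans hGK.le)) hlt
            by_contra hcon
            have : K ≤ G := hmax ⟨hFG.trans hGK.le, hlt, by omega⟩ hGK.le
            exact hGK.not_ge this
          · omega
        · change excess N B.1 = excess N G + 1
          omega
      rw [Finset.sum_eq_single G']
      · simp only [intervalDegree]
        rw [if_pos hd, if_pos hG₁, if_pos hG₂, if_neg]
        · rfl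
        · intro hcon
          exact (hdF.1 hcon).2 G hFG hGB hG1
      · -- two such flats `G` and `H` agree, since their join also has excess `1`
        intro H hH hHG
        rw [hs] at hH
        by_contra hne
        have hH₁ : IsDragon ⊥ H.1 N := by
          by_contra hn; exact hne (by rw [intervalDegree, if_neg hn, zero_mul])
        have hH₂ : IsDragon H.1 B.1 N := by
          by_contra hn; exact hne (by rw [mul_comm, intervalDegree, if_neg hn, zero_mul])
        obtain ⟨-, hH1, hH2, -⟩ := hsplit hH₁ hH₂
        have hHB : H.1 < B.1 := hH.2
        have hFH : F.1 ≤ H.1 := hH.1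
        have hsub := excess_submodular N G H.1
        have hinf := hpos (G ⊓ H.1) (ne (le_inf hFG hFH)) (inf_le_left.trans_lt hGB)
        have hGH : G ≤ H.1 := by
          by_contra hcon
          have := hH2 (G ⊔ H.1) (right_lt_sup.2 hcon) (sup_le hGB.le hHB.le)
          omega
        exact hHG (Subtype.ext (le_antisymm (hmax ⟨hFH, hHB, hH1⟩ hGH) hGH))
      · intro hcon
        exact absurd ((hs G').2 ⟨hFG, hGB⟩) hcon
    · push Not at hex
      rw [Finset.sum_eq_zero]
      · simp only [intervalDegree]
        rw [if_pos hd, if_pos (hdF.2 ⟨hd, hex⟩), sub_self]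
      · intro G hG
        rw [hs] at hG
        rw [intervalDegree, if_neg, zero_mul]
        rw [isDragon_bot_iff]
        exact fun hcon => hex G.1 hG.1 hG.2 hcon.2
  · rw [Finset.sum_eq_zero]
    · simp only [intervalDegree]
      rw [if_neg hd, if_neg fun hcon => hd (hdF.1 hcon).1, sub_self]
    · intro G hG
      by_contra hne
      have h₁ : IsDragon ⊥ G.1 N := by
        by_contra hn; exact hne (by rw [intervalDegree, if_neg hn, zero_mul])
      have h₂ : IsDragon G.1 B.1 N := by
        by_contra hn; exact hne (by rw [mul_comm, intervalDegree, if_neg hn, zero_mul])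
      obtain ⟨hG₁, hG₂, hG₃, hG₄⟩ := hsplit h₁ h₂
      refine hd (hdB.2 ⟨fun K hK hKB => ?_, hG₄⟩)
      by_cases hKG : K ≤ G.1
      · exact hG₁ K hK hKG
      have hsub := excess_submodular N K G.1
      have hsup := hG₃ (K ⊔ G.1) (right_lt_sup.2 hKG) (sup_le hKB.le ((hs G).1 hG).2.le)
      have hinf : 0 ≤ excess N (K ⊓ G.1) := by
        rcases eq_or_ne (K ⊓ G.1) ⊥ with hb | hb
        · rw [hb, excess_bot]
        · exact zero_le_one.trans (hG₁ _ hb inf_le_right)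
      omega

/-- If multiplication by `y` followed by the degree map restricts to the degree map of `[⊥, B]` on
the factors below `B`, then for each `F < B` multiplication by a further linear form `x` cuts the
interval `[⊥, B]` at `F`. (The form `x` is the class that corresponds to `F` in the presentation of
the Chow ring of `[⊥, B]` by the boundary divisors of the wonderful compactification.) -/
theorem exists_splitting_form [Finite L] {B : NonemptyFlat L} {y : ChowRing L}
    {ρ : (NonemptyFlat L →₀ ℕ) → ℤ}
    (hy : ∀ N, chowDegree (y * hMonomial N) = intervalDegree ⊥ B.1 N * ρ (above B.1 N))
    (F : NonemptyFlat L) (hFB : F < B) :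
    ∃ x ∈ grade L 1, ∀ N, chowDegree (x * y * hMonomial N) =
      intervalDegree ⊥ F.1 N * intervalDegree F.1 B.1 N * ρ (above B.1 N) := by
  induction F using WellFoundedGT.induction with
  | _ F ih =>
  choose! x hxg hx using ih
  have := Fintype.ofFinite (NonemptyFlat L)
  let t : Finset (NonemptyFlat L) := Finset.univ.filter fun G => F < G ∧ G < B
  refine ⟨h B - h F - ∑ G ∈ t, x G, ?_, fun N => ?_⟩
  · refine sub_mem (sub_mem (h_mem_grade B) (h_mem_grade F)) (sum_mem fun G hG => ?_)
    have hG := (Finset.mem_filter.1 hG).2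
    exact hxg G hG.1 hG.2
  · have hmul (G : NonemptyFlat L) (hG : G ≤ B) : chowDegree (h G * y * hMonomial N) =
        intervalDegree ⊥ B.1 (Finsupp.single G 1 + N) * ρ (above B.1 N) := by
      have : h G * y * hMonomial N = y * hMonomial (Finsupp.single G 1 + N) := by
        rw [hMonomial_add, hMonomial_single, pow_one]; ring
      rw [this, hy, above_add, above_single_of_le hG, zero_add]
    have hsplit := intervalDegree_split F B hFB N (insert F t) fun G => by
      simp only [t, Finset.mem_insert, Finset.mem_filter, Finset.mem_univ, true_and]
      constructor
      · rintro (rfl | hG)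
        · exact ⟨le_rfl, hFB⟩
        · exact ⟨hG.1.le, hG.2⟩
      · rintro ⟨h₁, h₂⟩
        rcases h₁.lt_or_eq with h₁ | h₁
        · exact Or.inr ⟨h₁, h₂⟩
        · exact Or.inl h₁.symm
    rw [Finset.sum_insert (by simp [t])] at hsplit
    have hsum : ∑ G ∈ t, chowDegree (x G * y * hMonomial N) =
        (∑ G ∈ t, intervalDegree ⊥ G.1 N * intervalDegree G.1 B.1 N) * ρ (above B.1 N) := by
      rw [Finset.sum_mul]
      refine Finset.sum_congr rfl fun G hG => ?_
      have hG := (Finset.mem_filter.1 hG).2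
      exact hx G hG.1 hG.2 N
    rw [sub_mul, sub_mul, sub_mul, sub_mul, map_sub, map_sub, hmul B le_rfl, hmul F hFB.le,
      Finset.sum_mul, Finset.sum_mul, map_sum, hsum]
    linear_combination ρ (above B.1 N) * hsplit

/-! ### Dual elements of the standard monomials -/

/-- A partial dual of a monomial: `m` is the part not below `B` of a standard monomial, and
multiplication by `y` followed by the degree map has the value of the degree map of `[⊥, B]` on the
factors below `B`, times a functional `ρ` on the other factors, which is unitriangular at `m` with
respect to the rank weight. -/
def HasPartialDual (B : NonemptyFlat L) (m : NonemptyFlat L →₀ ℕ) : Prop :=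
  ∃ (j : ℕ) (y : ChowRing L) (ρ : (NonemptyFlat L →₀ ℕ) → ℤ),
    y ∈ grade L j ∧ j + m.degree + rk B.1 = rk (⊤ : L) ∧ above B.1 m = m ∧ ρ m = 1 ∧
    (∀ N, chowDegree (y * hMonomial N) = intervalDegree ⊥ B.1 N * ρ (above B.1 N)) ∧
    ∀ N, flatCount B.1 N = 0 → ρ N ≠ 0 → N = m ∨ rankWeight N < rankWeight m

theorem hasPartialDual_top (htop : (⊤ : L) ≠ ⊥) : HasPartialDual (⟨⊤, htop⟩ : NonemptyFlat L) 0 := by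
  have habove (N : NonemptyFlat L →₀ ℕ) : above (⊤ : L) N = 0 := by
    ext F
    simp [above]
  refine ⟨0, 1, fun _ => 1, ?_, by simp, habove 0, rfl, fun N => ?_, fun N hN _ => Or.inl ?_⟩
  · simpa [hMonomial_zero] using hMonomial_mem_grade (0 : NonemptyFlat L →₀ ℕ)
  · rw [one_mul, mul_one, chowDegree_hMonomial]
  · rwa [flatCount_top, Finsupp.degree_eq_zero_iff] at hN

variable [Finite L]

/-- Extends a partial dual downwards by the power `h_B ^ a`: the interval `[⊥, B]` is cut at `F`, and
the power of `h_B` that is missing to the top degree of `[F, B]` is multiplied in. -/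
theorem HasPartialDual.extend {B : NonemptyFlat L} {m : NonemptyFlat L →₀ ℕ}
    (hm : HasPartialDual B m) {F : NonemptyFlat L} (hFB : F < B) {a : ℕ}
    (ha : a + rk F.1 < rk B.1) : HasPartialDual F (Finsupp.single B a + m) := by
  obtain ⟨j, y, ρ, hyg, hj, hmB, hρm, hy, hρ⟩ := hm
  obtain ⟨x, hxg, hx⟩ := exists_splitting_form hy F hFB
  have hFB' : F.1 < B.1 := hFB
  obtain ⟨c, hc⟩ : ∃ c, a + c + 1 + rk F.1 = rk B.1 := ⟨rk B.1 - rk F.1 - 1 - a, by omega⟩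
  have hB0 : flatCount B.1 m = 0 := by rw [← hmB, flatCount_above_self]
  have hmono {K : L} (hK : K ≤ B.1) : flatCount K m = 0 := by
    have := flatCount_above hK m
    omega
  refine ⟨c + 1 + j, hMonomial (Finsupp.single B c) * (x * y),
    fun N => intervalDegree F.1 B.1 (Finsupp.single B c + N) * ρ (above B.1 N), ?_, ?_, ?_, ?_, ?_,
    ?_⟩
  · have h₁ := hMonomial_mem_grade (Finsupp.single B c)
    rw [Finsupp.degree_single] at h₁
    rw [add_assoc]
    exact mul_mem_grade h₁ (mul_mem_grade hxg hyg)
  · simp only [map_add, Finsupp.degree_single]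
    omega
  · rw [above_add, above_single_of_not_le hFB'.not_ge, ← hmB, above_of_above hFB'.le]
  · have hdragon : IsDragon F.1 B.1 (Finsupp.single B c + (Finsupp.single B a + m)) := by
      have hK {K : L} (hK : K < B.1) :
          excess (Finsupp.single B c + (Finsupp.single B a + m)) K = rk K := by
        rw [excess_single_self_of_lt hK, excess_single_self_of_lt hK, excess, hmono hK.le]
        simp
      have hB : excess (Finsupp.single B c + (Finsupp.single B a + m)) B.1 = rk F.1 + 1 := by
        rw [excess_single_add, excess_single_add, if_pos le_rfl, if_pos le_rfl, excess, hB0]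
        omega
      rw [IsDragon, hB, hK hFB']
      refine ⟨fun K hFK hKB => ?_, rfl⟩
      rcases hKB.lt_or_eq with hlt | rfl
      · rw [hK hlt]
        have := rk_lt_rk hFK
        omega
      · rw [hB]
    simp only [intervalDegree]
    rw [if_pos hdragon, above_add, above_single_of_le le_rfl, zero_add, hmB, hρm, one_mul]
  · intro N
    beta_reduce
    have h₁ : hMonomial (Finsupp.single B c) * (x * y) * hMonomial N =
        x * y * hMonomial (Finsupp.single B c + N) := by
      rw [hMonomial_add]; ring
    have h₂ : intervalDegree ⊥ F.1 (Finsupp.single B c + N) = intervalDegree ⊥ F.1 N := by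
      have hK (K : L) (hK : K ≤ F.1) : excess (Finsupp.single B c + N) K = excess N K :=
        excess_single_self_of_lt (hK.trans_lt hFB') c N
      have : IsDragon ⊥ F.1 (Finsupp.single B c + N) ↔ IsDragon ⊥ F.1 N := by
        rw [isDragon_bot_iff, isDragon_bot_iff, hK _ le_rfl]
        exact and_congr_left' (forall₃_congr fun K _ hKF => by rw [hK K hKF])
      simp only [intervalDegree, this]
    rw [h₁, hx, h₂, ← intervalDegree_above (Finsupp.single B c + N) hFB'.le, above_add, above_add,
      above_single_of_not_le hFB'.not_ge, above_single_of_le le_rfl, zero_add, above_above hFB'.le,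
      mul_assoc]
  · intro N hN hne
    have hdragon : IsDragon F.1 B.1 (Finsupp.single B c + N) := by
      by_contra hn
      exact hne (by simp only [intervalDegree]; rw [if_neg hn, zero_mul])
    have hcount : flatCount B.1 N = a := by
      have := hdragon.2
      rw [excess_single_self_of_lt hFB', excess_single_add, if_pos le_rfl, excess, excess, hN]
        at this
      omega
    have hupper := hρ (above B.1 N) (flatCount_above_self _ _) (right_ne_zero_of_mul hne)
    have hlower := eq_or_rankWeight_lt B N
    rw [hcount] at hlower
    rw [map_add, rankWeight_single]
    rcases hupper with hu | hu
    · rw [hu] at hlower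
      exact hlower
    · right
      rcases hlower with hl | hl
      · have := congrArg rankWeight hl
        rw [map_add, rankWeight_single] at this
        omega
      · omega

/-- `y` is dual to the monomial with exponent vector `m`, up to monomials of smaller rank weight: it
has the complementary degree, pairs to `1` with this monomial, and to `0` with all others whose rank
weight is not smaller. -/
def IsDual (m : NonemptyFlat L →₀ ℕ) (y : ChowRing L) : Prop :=
  y ∈ grade L (rk (⊤ : L) - 1 - m.degree) ∧ chowDegree (y * hMonomial m) = 1 ∧
    ∀ N, chowDegree (y * hMonomial N) ≠ 0 → N = m ∨ rankWeight N < rankWeight m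

theorem HasPartialDual.exists_isDual {B : NonemptyFlat L} {m : NonemptyFlat L →₀ ℕ}
    (hm : HasPartialDual B m) {a : ℕ} (ha : a < rk B.1) :
    ∃ y, IsDual (Finsupp.single B a + m) y := by
  obtain ⟨j, y, ρ, hyg, hj, hmB, hρm, hy, hρ⟩ := hm
  obtain ⟨c, hc⟩ : ∃ c, a + c + 1 = rk B.1 := ⟨rk B.1 - 1 - a, by omega⟩
  have hB0 : flatCount B.1 m = 0 := by rw [← hmB, flatCount_above_self]
  have hdeg (N : NonemptyFlat L →₀ ℕ) :
      chowDegree (hMonomial (Finsupp.single B c) * y * hMonomial N) =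
        intervalDegree ⊥ B.1 (Finsupp.single B c + N) * ρ (above B.1 N) := by
    have : hMonomial (Finsupp.single B c) * y * hMonomial N =
        y * hMonomial (Finsupp.single B c + N) := by
      rw [hMonomial_add]; ring
    rw [this, hy, above_add, above_single_of_le le_rfl, zero_add]
  refine ⟨hMonomial (Finsupp.single B c) * y, ?_, ?_, fun N hne => ?_⟩
  · have h₁ := hMonomial_mem_grade (Finsupp.single B c)
    rw [Finsupp.degree_single] at h₁
    have h₂ := mul_mem_grade h₁ hyg
    convert h₂ using 2
    simp only [map_add, Finsupp.degree_single]
    omega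
  · have hdragon : IsDragon ⊥ B.1 (Finsupp.single B c + (Finsupp.single B a + m)) := by
      have hB : excess (Finsupp.single B c + (Finsupp.single B a + m)) B.1 = 1 := by
        rw [excess_single_add, excess_single_add, if_pos le_rfl, if_pos le_rfl, excess, hB0]
        omega
      rw [isDragon_bot_iff]
      refine ⟨fun K hK hKB => ?_, hB⟩
      rcases hKB.lt_or_eq with hlt | rfl
      · have h₁ := flatCount_above hKB m
        have h₂ := rk_pos hK
        rw [excess_single_self_of_lt hlt, excess_single_self_of_lt hlt, excess]
        omega
      · rw [hB]
    rw [hdeg, intervalDegree, if_pos hdragon, above_add, above_single_of_le le_rfl, zero_add, hmB,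
      hρm, one_mul]
  · rw [hdeg] at hne
    have hdragon : IsDragon ⊥ B.1 (Finsupp.single B c + N) := by
      by_contra hn
      exact hne (by rw [intervalDegree, if_neg hn, zero_mul])
    have hcount : flatCount B.1 N = a := by
      have := (isDragon_bot_iff.1 hdragon).2
      rw [excess_single_add, if_pos le_rfl, excess] at this
      omega
    have hupper := hρ (above B.1 N) (flatCount_above_self _ _) (right_ne_zero_of_mul hne)
    have hlower := eq_or_rankWeight_lt B N
    rw [hcount] at hlower
    rw [map_add, rankWeight_single]
    rcases hupper with hu | hu
    · rw [hu] at hlower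
      exact hlower
    · right
      rcases hlower with hl | hl
      · have := congrArg rankWeight hl
        rw [map_add, rankWeight_single] at this
        omega
      · omega

/-- Builds a dual by descending along the chain of flats of the standard monomial `n`. -/
theorem IsStandard.exists_isDual_of_partial {n : NonemptyFlat L →₀ ℕ} (hn : IsStandard n)
    {B : NonemptyFlat L} {m : NonemptyFlat L →₀ ℕ} (hm : HasPartialDual B m) {a : ℕ}
    (ha : a < rk B.1) (hB : ∀ G ∈ n.support, G < B ∧ a + rk G.1 < rk B.1) :
    ∃ y, IsDual (n + (Finsupp.single B a + m)) y := by
  induction hc : n.support.card generalizing n B m a with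
  | zero =>
    have : n = 0 := by simpa using hc
    rw [this, zero_add]
    exact hm.exists_isDual ha
  | succ k ih =>
    have hne : n.support.Nonempty := Finset.card_pos.1 (by omega)
    obtain ⟨F, hF, hmax⟩ := n.support.exists_maximal hne
    have hlt {G : NonemptyFlat L} (hG : G ∈ (n.erase F).support) : G ∈ n.support ∧ G < F := by
      rw [Finsupp.support_erase, Finset.mem_erase] at hG
      refine ⟨hG.2, lt_of_le_of_ne ?_ hG.1⟩
      exact (hn.isChain.total hG.2 hF).elim id fun hle => hmax hG.2 hle
    have := ih (hn.erase F) (hm.extend (hB F hF).1 (hB F hF).2) (hn.lt_rk F hF)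
      (fun G hG => ⟨(hlt hG).2, hn.add_rk_lt_rk G (hlt hG).1 F hF (hlt hG).2⟩)
      (by rw [Finsupp.support_erase, Finset.card_erase_of_mem hF, hc, Nat.add_sub_cancel])
    rwa [← add_assoc, Finsupp.erase_add_single] at this

theorem IsStandard.exists_isDual (htop : (⊤ : L) ≠ ⊥) {m : NonemptyFlat L →₀ ℕ}
    (hm : IsStandard m) : ∃ y, IsDual m y := by
  let T : NonemptyFlat L := ⟨⊤, htop⟩
  have hpos : 0 < rk (⊤ : L) := rk_pos htop
  have hT : m T < rk (⊤ : L) := by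
    by_cases h : T ∈ m.support
    · exact hm.lt_rk T h
    · rwa [Finsupp.notMem_support_iff.1 h]
  have := (hm.erase T).exists_isDual_of_partial (hasPartialDual_top htop) hT fun G hG => by
    rw [Finsupp.support_erase, Finset.mem_erase] at hG
    have hGT : G < T := lt_of_le_of_ne le_top hG.1
    refine ⟨hGT, ?_⟩
    by_cases h : T ∈ m.support
    · exact hm.add_rk_lt_rk G hG.2 T h hGT
    · rw [Finsupp.notMem_support_iff.1 h, zero_add]
      exact rk_lt_rk (Subtype.coe_lt_coe.2 hGT)
  rwa [← add_assoc, Finsupp.erase_add_single, add_zero] at this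

end

section

open scoped Classical

variable {L : Type*} [Lattice L] [BoundedOrder L] [Finite L] [IsMatroidLattice L]

/-! ### The basis of standard monomials and Poincaré duality -/

theorem grade_le_span_standard (k : ℕ) :
    grade L k ≤ Submodule.span ℤ (hMonomial '' {n | IsStandard n ∧ n.degree = k}) := by
  rw [grade_eq_span, Submodule.span_le]
  rintro _ ⟨N, rfl, rfl⟩
  exact hMonomial_mem_span_standard N

theorem span_standardExponents :
    Submodule.span ℤ (Set.range fun m : standardExponents L => hMonomial m.1) = ⊤ := by
  rw [eq_top_iff, ← span_hMonomial, Submodule.span_le]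
  rintro _ ⟨N, rfl⟩
  refine Submodule.span_mono ?_ (hMonomial_mem_span_standard N)
  rintro _ ⟨n, ⟨hn, -⟩, rfl⟩
  exact ⟨⟨n, mem_standardExponents_of_isStandard hn⟩, rfl⟩

/-- A combination of standard monomials on which the duals of all monomials involved vanish is
trivial: test with a dual of a monomial of least rank weight. -/
theorem eq_zero_of_dual_eq_zero (htop : (⊤ : L) ≠ ⊥) (c : (NonemptyFlat L →₀ ℕ) →₀ ℤ)
    (hc : ∀ m ∈ c.support, IsStandard m)
    (H : ∀ m ∈ c.support, ∀ y, IsDual m y →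
      chowDegree (y * Finsupp.linearCombination ℤ hMonomial c) = 0) : c = 0 := by
  by_contra hne
  obtain ⟨m, hm, hmin⟩ := c.support.exists_min_image rankWeight (Finsupp.support_nonempty_iff.2 hne)
  obtain ⟨y, hy⟩ := (hc m hm).exists_isDual htop
  have h0 := H m hm y hy
  rw [Finsupp.linearCombination_apply, Finsupp.sum, Finset.mul_sum, map_sum,
    Finset.sum_eq_single_of_mem m hm, mul_smul_comm, map_smul, hy.2.1, smul_eq_mul, mul_one] at h0
  · exact Finsupp.mem_support_iff.1 hm h0
  · intro n hn hnm
    rw [mul_smul_comm, map_smul]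
    by_contra hne'
    rcases hy.2.2 n (right_ne_zero_of_smul hne') with h₁ | h₁
    · exact hnm h₁
    · exact absurd (hmin n hn) (not_le.2 h₁)

theorem linearIndepOn_standardExponents :
    LinearIndepOn ℤ (hMonomial : (NonemptyFlat L →₀ ℕ) → ChowRing L) (standardExponents L) := by
  rw [linearIndepOn_iff]
  intro c hc h0
  by_cases htop : (⊤ : L) = ⊥
  · -- the lattice has one element, and the Chow ring is `ℤ`
    have hempty : IsEmpty (NonemptyFlat L) :=
      ⟨fun F => F.2 (le_bot_iff.1 (le_top.trans_eq htop))⟩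
    have hbot : chowIdeal L = ⊥ := by
      rw [chowIdeal, Ideal.span_eq_bot]
      rintro x (⟨F, -⟩ | ⟨F, -⟩) <;> exact isEmptyElim F
    have hsum : Finsupp.linearCombination ℤ (hMonomial : _ → ChowRing L) c =
        Ideal.Quotient.mk (chowIdeal L) (MvPolynomial.C (c 0)) := by
      rw [Finsupp.linearCombination_apply, Finsupp.sum_eq_single 0]
      · rw [hMonomial_zero, zsmul_eq_mul, mul_one]
        exact (map_intCast ((Ideal.Quotient.mk (chowIdeal L)).comp MvPolynomial.C) (c 0)).symm
      · intro m _ hm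
        exact absurd (Subsingleton.elim m 0) hm
      · simp
    rw [hsum, Ideal.Quotient.eq_zero_iff_mem, hbot, Ideal.mem_bot, MvPolynomial.C_eq_zero] at h0
    refine Finsupp.ext fun m => ?_
    rw [Subsingleton.elim m 0, h0, Finsupp.coe_zero, Pi.zero_apply]
  · refine eq_zero_of_dual_eq_zero htop c (fun m hm => ?_) fun m _ y _ => by rw [h0, mul_zero, map_zero]
    exact isStandard_of_mem_standardExponents ((Finsupp.mem_supported _ _).1 hc hm)

theorem eq_zero_of_chowDegree_mul_eq_zero (htop : (⊤ : L) ≠ ⊥) {k l : ℕ}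
    (hkl : k + l = rk (⊤ : L) - 1) {x : ChowRing L} (hx : x ∈ grade L k)
    (H : ∀ y ∈ grade L l, chowDegree (x * y) = 0) : x = 0 := by
  obtain ⟨c, hc, rfl⟩ :=
    (Finsupp.mem_span_image_iff_linearCombination ℤ).1 (grade_le_span_standard k hx)
  rw [Finsupp.mem_supported] at hc
  rw [eq_zero_of_dual_eq_zero htop c (fun m hm => (hc hm).1) fun m hm y hy => ?_, map_zero]
  rw [mul_comm]
  refine H y ?_
  have hyg := hy.1
  rwa [(hc hm).2, ← hkl, Nat.add_sub_cancel_left] at hyg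

/-- Every functional on a graded piece is the pairing with some element: prescribe the values at the
standard monomials in the order of decreasing rank weight, and correct with duals. -/
theorem exists_chowDegree_mul_eq (htop : (⊤ : L) ≠ ⊥) {k l : ℕ} (hkl : k + l = rk (⊤ : L) - 1)
    (g : grade L l →ₗ[ℤ] ℤ) :
    ∃ y ∈ grade L k, ∀ x : grade L l, chowDegree (y * (x : ChowRing L)) = g x := by
  have hfin : {n : NonemptyFlat L →₀ ℕ | IsStandard n ∧ n.degree = l}.Finite :=
    (Finsupp.finite_of_degree_eq l).subset fun n hn => hn.2
  choose! d hd using fun (m : NonemptyFlat L →₀ ℕ) (hm : IsStandard m) => hm.exists_isDual htop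
  let v (n : NonemptyFlat L →₀ ℕ) : ℤ :=
    if hn : n.degree = l then g ⟨hMonomial n, hn ▸ hMonomial_mem_grade n⟩ else 0
  have main (b : ℕ) : ∃ y ∈ grade L k, ∀ n, IsStandard n → n.degree = l →
      l * rk (⊤ : L) < rankWeight n + b → chowDegree (y * hMonomial n) = v n := by
    induction b with
    | zero =>
      refine ⟨0, zero_mem _, fun n _ hn hlt => ?_⟩
      have := rankWeight_le n
      rw [hn] at this
      omega
    | succ b ih =>
      obtain ⟨y, hyg, hy⟩ := ih
      let t := hfin.toFinset.filter fun n => rankWeight n + b = l * rk (⊤ : L)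
      have ht {n : NonemptyFlat L →₀ ℕ} : n ∈ t ↔
          (IsStandard n ∧ n.degree = l) ∧ rankWeight n + b = l * rk (⊤ : L) := by
        simp [t]
      refine ⟨y + ∑ m ∈ t, (v m - chowDegree (y * hMonomial m)) • d m,
        add_mem hyg (sum_mem fun m hm => Submodule.smul_mem _ _ ?_), fun n hn hnl hlt => ?_⟩
      · have := (hd m (ht.1 hm).1.1).1
        rwa [(ht.1 hm).1.2, ← hkl, Nat.add_sub_cancel] at this
      · have hval : chowDegree ((y + ∑ m ∈ t, (v m - chowDegree (y * hMonomial m)) • d m) *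
            hMonomial n) = chowDegree (y * hMonomial n) +
            ∑ m ∈ t, (v m - chowDegree (y * hMonomial m)) * chowDegree (d m * hMonomial n) := by
          simp only [add_mul, Finset.sum_mul, smul_mul_assoc, map_add, map_sum, map_smul,
            smul_eq_mul]
        have hzero {m : NonemptyFlat L →₀ ℕ} (hm : m ∈ t) (hmn : m ≠ n) :
            (v m - chowDegree (y * hMonomial m)) * chowDegree (d m * hMonomial n) = 0 := by
          by_contra hne
          rcases (hd m (ht.1 hm).1.1).2.2 n (right_ne_zero_of_mul hne) with h₁ | h₁
          · exact hmn h₁.symm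
          · have := (ht.1 hm).2
            omega
        rw [hval]
        by_cases hnt : n ∈ t
        · rw [Finset.sum_eq_single_of_mem n hnt fun m hm hmn => hzero hm hmn, (hd n hn).2.1]
          ring
        · rw [Finset.sum_eq_zero fun m hm => hzero hm fun e => hnt (e ▸ hm), add_zero]
          refine hy n hn hnl ?_
          have : rankWeight n + b ≠ l * rk (⊤ : L) := fun e => hnt (ht.2 ⟨⟨hn, hnl⟩, e⟩)
          omega
  obtain ⟨y, hyg, hy⟩ := main (l * rk (⊤ : L) + 1)
  refine ⟨y, hyg, fun x => ?_⟩
  suffices H : ∀ x ∈ Submodule.span ℤ (hMonomial '' {n | IsStandard n ∧ n.degree = l}),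
      ∃ hx : x ∈ grade L l, chowDegree (y * x) = g ⟨x, hx⟩ from
    (H x.1 (grade_le_span_standard l x.2)).2
  intro x hx
  induction hx using Submodule.span_induction with
  | zero => exact ⟨zero_mem _, by rw [mul_zero, map_zero]; exact (map_zero g).symm⟩
  | add x x' _ _ hx hx' =>
    obtain ⟨hx, ex⟩ := hx
    obtain ⟨hx', ex'⟩ := hx'
    refine ⟨add_mem hx hx', ?_⟩
    rw [mul_add, map_add, ex, ex', ← map_add]
    rfl
  | smul a x _ hx =>
    obtain ⟨hx, ex⟩ := hx
    refine ⟨Submodule.smul_mem _ a hx, ?_⟩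
    rw [mul_smul_comm, map_smul, ex, ← map_smul]
    rfl
  | mem x hx =>
    obtain ⟨n, ⟨hn, hnl⟩, rfl⟩ := hx
    refine ⟨hnl ▸ hMonomial_mem_grade n, ?_⟩
    rw [hy n hn hnl (by omega)]
    exact dif_pos hnl

theorem bijective_chowDegree_domRestrict (htop : (⊤ : L) ≠ ⊥) :
    Function.Bijective (chowDegree.domRestrict (grade L (rk (⊤ : L) - 1))) := by
  constructor
  · rw [injective_iff_map_eq_zero]
    rintro ⟨x, hx⟩ h0
    refine Subtype.ext (eq_zero_of_chowDegree_mul_eq_zero htop (l := 0) rfl hx fun y hy => ?_)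
    rw [grade_eq_span] at hy
    induction hy using Submodule.span_induction with
    | zero => rw [mul_zero, map_zero]
    | add y y' _ _ hy hy' => rw [mul_add, map_add, hy, hy', add_zero]
    | smul a y _ hy => rw [mul_smul_comm, map_smul, hy, smul_zero]
    | mem y hy =>
      obtain ⟨N, hN, rfl⟩ := hy
      rw [(Finsupp.degree_eq_zero_iff N).1 hN, hMonomial_zero, mul_one]
      exact h0
  · intro n
    have hstd : IsStandard (0 : NonemptyFlat L →₀ ℕ) := ⟨by simp, by simp, by simp⟩
    obtain ⟨y, hyg, hy, -⟩ := hstd.exists_isDual htop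
    rw [hMonomial_zero, mul_one] at hy
    rw [map_zero, Nat.sub_zero] at hyg
    refine ⟨n • ⟨y, hyg⟩, ?_⟩
    rw [map_smul, LinearMap.domRestrict_apply, hy, smul_eq_mul, mul_one]

theorem chowDegree_prod_h {d : ℕ} (hd : d + 1 = rk (⊤ : L)) (F : Fin d → NonemptyFlat L) :
    chowDegree (∏ i, h (F i)) = if DragonHallRado F then 1 else 0 := by
  have : ∏ i, h (F i) = hMonomial (∑ i, Finsupp.single (F i) 1) := by
    induction (Finset.univ : Finset (Fin d)) using Finset.induction_on with
    | empty => rw [Finset.prod_empty, Finset.sum_empty, hMonomial_zero]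
    | insert i s hi ih =>
      rw [Finset.prod_insert hi, Finset.sum_insert hi, hMonomial_add, hMonomial_single, pow_one, ih]
  rw [this, chowDegree_hMonomial]
  simp only [intervalDegree, isDragon_sum_single_iff hd]

end

end MatroidChow

theorem theorem1p1 {L : Type*} [Lattice L] [BoundedOrder L] [Finite L]
    [MatroidChow.IsMatroidLattice L] (r : ℕ) (hr : MatroidChow.rk (⊤ : L) = r) :
    -- the standard monomials form an integral basis
    (LinearIndependent ℤ
        (fun m : MatroidChow.standardExponents L => MatroidChow.hMonomial m.1) ∧
      Submodule.span ℤ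
        (Set.range fun m : MatroidChow.standardExponents L => MatroidChow.hMonomial m.1) = ⊤) ∧
    (1 ≤ r →
      ∃ deg : MatroidChow.grade L (r - 1) ≃ₗ[ℤ] ℤ,
        -- the dragon Hall–Rado formula
        (∀ F : Fin (r - 1) → MatroidChow.NonemptyFlat L,
          (MatroidChow.DragonHallRado F → deg (MatroidChow.hProd F) = 1) ∧
          (¬ MatroidChow.DragonHallRado F → deg (MatroidChow.hProd F) = 0)) ∧
        -- Poincaré duality
        (∀ (k l : ℕ) (hkl : k + l = r - 1),
          Function.Bijective (MatroidChow.pairing hkl deg.toLinearMap))) := by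
  subst hr
  refine ⟨⟨MatroidChow.linearIndepOn_standardExponents, MatroidChow.span_standardExponents⟩,
    fun hr => ?_⟩
  have htop : (⊤ : L) ≠ ⊥ := fun e => by
    rw [e, MatroidChow.rk_bot] at hr
    omega
  refine ⟨LinearEquiv.ofBijective _ (MatroidChow.bijective_chowDegree_domRestrict htop),
    fun F => ?_, fun k l hkl => ⟨?_, fun g => ?_⟩⟩
  · have hF := MatroidChow.chowDegree_prod_h (Nat.sub_add_cancel hr) F
    exact ⟨fun hd => hF.trans (if_pos hd), fun hd => hF.trans (if_neg hd)⟩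
  · rw [injective_iff_map_eq_zero]
    rintro ⟨x, hx⟩ h0
    exact Subtype.ext (MatroidChow.eq_zero_of_chowDegree_mul_eq_zero htop hkl hx fun y hy =>
      LinearMap.congr_fun h0 ⟨y, hy⟩)
  · obtain ⟨y, hyg, hy⟩ := MatroidChow.exists_chowDegree_mul_eq htop hkl g
    exact ⟨⟨y, hyg⟩, LinearMap.ext hy⟩
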